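/- There are universal constants $c, C > 0$ and $d_0$ such that the following holds for every dimension $d_x \ge d_0$. Let $\mathcal{A}$ be any randomized black-box control algorithm with states and controls in $\mathbb{R}^{d_x}$: its control at time $t$ is a function $u_t = \mathcal{A}(x_1,\dots,x_t,c_1,\dots,c_t,u_1,\dots,u_{t-1},\sigma_t)$ of the observed states, the revealed cost functions, its past controls and a random string $\sigma_t$, where the strings are random variables on a probability space that does not depend on the control problem. Then there is a noiseless control problem $x_{t+1} = A x_t + u_t$ (that is, $B = I$), $A \in \mathbb{R}^{d_x \times d_x}$, with $x_1 = e_1$ and costs $c_t(x,u) = \|x\|^2 + \|u\|^2$ for all $t$, which has the following properties. (i) The system is stabilizable: for some $K$, $\tilde\kappa \ge 1$ and $0 < \gamma \le 1$, the linear controller $u_t = K x_t$ is $(\tilde\kappa,\gamma)$-strongly stable, i.e. $\|K\| \le \tilde\kappa$ and $A + BK = H \Lambda H^{-1}$ with $\|H\|\,\|H^{-1}\| \le \tilde\kappa$ and $\|\Lambda\| \le 1-\gamma$. (ii) The system is $(1,1)$-strongly controllable, where $(A,B)$ is called $(k,\kappa)$-strongly controllable if $C_k = [B\ AB\ \cdots\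 A^{k-1}B]$ has full row rank and $\|(C_k C_k^\top)^{-1}\| \le \kappa$. (iii) With $k = \kappa = 1$, $d_u = d_x$, some $\beta \ge 1$ with $\|A\|, \|B\| \le \beta$, and some $G$ such that $\|\nabla c_t(x,u)\| \le G D$ for all $t$ and $D$ and all $x, u$ with $\|x\|, \|u\| \le D$, the complexity $\mathcal{L} = k d_u + d_x + G + \beta + \kappa$ of the system satisfies $\mathcal{L} \le C d_x$. (iv) With $T = \lfloor d_x/8 \rfloor$, with probability at least $1 - \exp(-d_x/100)$ over the random strings of $\mathcal{A}$, $$\mathrm{Regret}_T(\mathcal{A}) \ge 2^{c\mathcal{L}}.$$ Here $\mathrm{Regret}_T(\mathcal{A}) = \sum_{t=1}^T c_t(x_t,u_t) - \inf_{\pi\in\Pi} \sum_{t=1}^T c_t(x_t^\pi,u_t^\pi)$ is the realized regret, and the bound holds, on the same event, both for the class $\Pi$ of all disturbance-action controllers $u_t = K x_t + \sum_{i=1}^H M^{i-1} w_{t-i}$ (with disturbances $w_t = 0$ here) and for the class $\Pi$ of all strongly stable linear controllers of the system. Matrix norms are spectral norms. -/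

import Mathlib

open MeasureTheory
open scoped Matrix Matrix.Norms.L2Operator

namespace BlackBoxControl

/-- The Euclidean space `ℝⁿ`. -/
abbrev Vec (n : ℕ) : Type := EuclideanSpace ℝ (Fin n)

/-- Cost functions `c(x, u)` of a state and a control. -/
abbrev Cost (dx du : ℕ) : Type := Vec dx → Vec du → ℝ

/-- The product of a matrix with a vector, between Euclidean spaces. -/
noncomputable def app {m n : ℕ} (A : Matrix (Fin m) (Fin n) ℝ) (x : Vec n) : Vec m :=
  WithLp.toLp 2 (A *ᵥ x.ofLp)

/-- The first standard basis vector of `ℝⁿ`. -/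
noncomputable def e1 (n : ℕ) : Vec n :=
  WithLp.toLp 2 (fun i => if (i : ℕ) = 0 then 1 else 0)

/-! Norms of matrices are spectral norms (operator norms for the Euclidean norms).
Time is indexed from `0`: the states `x₁, x₂, …` are `x 0, x 1, …`, and likewise for the controls,
disturbances and costs. -/

/-- The block matrix `C_k = [B  AB  ⋯  A^{k-1}B]`. The column `(j, l)` is column `l` of `A^j B`. -/
def controllabilityMatrix {dx du : ℕ} (A : Matrix (Fin dx) (Fin dx) ℝ)
    (B : Matrix (Fin dx) (Fin du) ℝ) (k : ℕ) : Matrix (Fin dx) (Fin k × Fin du) ℝ :=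
  Matrix.of fun i p => (A ^ (p.1 : ℕ) * B) i p.2

/-- `(k, κ)`-strong controllability: `C_k` has full row rank and `‖(C_k C_kᵀ)⁻¹‖ ≤ κ`. -/
def StronglyControllable {dx du : ℕ} (A : Matrix (Fin dx) (Fin dx) ℝ)
    (B : Matrix (Fin dx) (Fin du) ℝ) (k : ℕ) (κ : ℝ) : Prop :=
  (controllabilityMatrix A B k).rank = dx ∧
    ‖(controllabilityMatrix A B k * (controllabilityMatrix A B k)ᵀ)⁻¹‖ ≤ κ

/-- `K` is a `(κ, γ)`-strongly stable controller for `(A, B)`. -/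
def StronglyStable {dx du : ℕ} (A : Matrix (Fin dx) (Fin dx) ℝ)
    (B : Matrix (Fin dx) (Fin du) ℝ) (K : Matrix (Fin du) (Fin dx) ℝ) (κ γ : ℝ) : Prop :=
  1 ≤ κ ∧ 0 < γ ∧ γ ≤ 1 ∧ ‖K‖ ≤ κ ∧
    ∃ H L : Matrix (Fin dx) (Fin dx) ℝ, IsUnit H.det ∧ A + B * K = H * L * H⁻¹ ∧
      ‖H‖ * ‖H⁻¹‖ ≤ κ ∧ ‖L‖ ≤ 1 - γ

/-- `(A, B)` is stabilizable: it has a strongly stable linear controller. -/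
def Stabilizable {dx du : ℕ} (A : Matrix (Fin dx) (Fin dx) ℝ)
    (B : Matrix (Fin dx) (Fin du) ℝ) : Prop :=
  ∃ (K : Matrix (Fin du) (Fin dx) ℝ) (κ γ : ℝ), StronglyStable A B K κ γ

/-- A control problem instance: a system `(A, B)`, an initial state, and an oblivious (fixed in
advance) sequence of convex cost functions. -/
structure Problem (dx du : ℕ) where
  A : Matrix (Fin dx) (Fin dx) ℝ
  B : Matrix (Fin dx) (Fin du) ℝ
  x₁ : Vec dx
  cost : ℕ → Cost dx du
  convex_cost : ∀ t, ConvexOn ℝ Set.univ (fun p : Vec dx × Vec du => cost t p.1 p.2)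

/-- The dynamics `x_{t+1} = A x_t + B u_t + w_t`. -/
noncomputable def Problem.step {dx du : ℕ} (I : Problem dx du) (x : Vec dx) (u : Vec du)
    (w : Vec dx) : Vec dx :=
  app I.A x + app I.B u + w

/-- The total cost over `T` iterations of a sequence of states and controls. -/
noncomputable def Problem.totalCost {dx du : ℕ} (I : Problem dx du) (T : ℕ)
    (x : ℕ → Vec dx) (u : ℕ → Vec du) : ℝ :=
  ∑ t ∈ Finset.range T, I.cost t (x t) (u t)

/-- The cost `c` vanishes at the origin, and `‖∇c(x, u)‖ ≤ G D` whenever `‖x‖, ‖u‖ ≤ D`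
(the gradient is taken in the Euclidean space of pairs `(x, u)`). -/
def CostGradientBound {dx du : ℕ} (c : Cost dx du) (G : ℝ) : Prop :=
  c 0 0 = 0 ∧
    Differentiable ℝ (fun p : WithLp 2 (Vec dx × Vec du) => c p.fst p.snd) ∧
    ∀ (D : ℝ) (p : WithLp 2 (Vec dx × Vec du)), ‖p.fst‖ ≤ D → ‖p.snd‖ ≤ D →
      ‖gradient (fun p : WithLp 2 (Vec dx × Vec du) => c p.fst p.snd) p‖ ≤ G * D

/-- `k, κ, G, β` are valid natural parameters of the control problem. -/
def Problem.HasParams {dx du : ℕ} (I : Problem dx du) (k : ℕ) (κ G β : ℝ) : Prop :=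
  1 ≤ κ ∧ StronglyControllable I.A I.B k κ ∧
    1 ≤ β ∧ ‖I.A‖ ≤ β ∧ ‖I.B‖ ≤ β ∧
    ∀ t, CostGradientBound (I.cost t) G

/-- The complexity `𝓛 = k d_u + d_x + G + β + κ` of a system. -/
def systemSize (dx du k : ℕ) (κ G β : ℝ) : ℝ :=
  (k : ℝ) * du + dx + G + β + κ

/-- A randomized black-box control algorithm with random strings `σ_t`, which are random variables
on a common space `Ω` (with no restriction on their joint law). The control `u_t` is a (measurable)
function of the states `x_1, …, x_t`, the cost functions `c_1, …, c_t`,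
the controls `u_1, …, u_{t-1}` and `σ_t`. -/
structure Algorithm (dx du : ℕ) (Ω : Type*) [MeasurableSpace Ω]
    (S : ℕ → Type*) [∀ t, MeasurableSpace (S t)] where
  σ : ∀ t, Ω → S t
  control : ∀ t : ℕ, (Fin (t + 1) → Vec dx) → (Fin (t + 1) → Cost dx du) → (Fin t → Vec du) →
    S t → Vec du
  measurable_σ : ∀ t, Measurable (σ t)
  measurable_control : ∀ t (c : Fin (t + 1) → Cost dx du),
    Measurable (fun p : (Fin (t + 1) → Vec dx) × (Fin t → Vec du) × S t =>
      control t p.1 c p.2.1 p.2.2)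

namespace Algorithm

variable {dx du : ℕ} {Ω : Type*} [MeasurableSpace Ω] {S : ℕ → Type*} [∀ t, MeasurableSpace (S t)]

/-- The next control, given the past states and controls. -/
def next (𝒜 : Algorithm dx du Ω S) (I : Problem dx du) (ω : Ω) (t : ℕ)
    (h : (Fin (t + 1) → Vec dx) × (Fin t → Vec du)) : Vec du :=
  𝒜.control t h.1 (fun s => I.cost s) h.2 (𝒜.σ t ω)

/-- The states `x_1, …, x_t` and the controls `u_1, …, u_{t-1}` that are produced when the
algorithm runs on the problem with disturbances `w`. -/
noncomputable def history (𝒜 : Algorithm dx du Ω S) (I : Problem dx du) (w : ℕ → Vec dx) (ω : Ω) :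
    ∀ t : ℕ, (Fin (t + 1) → Vec dx) × (Fin t → Vec du)
  | 0 => (fun _ => I.x₁, Fin.elim0)
  | t + 1 =>
    (Fin.snoc (α := fun _ => Vec dx) (history 𝒜 I w ω t).1
      (I.step ((history 𝒜 I w ω t).1 (Fin.last t)) (𝒜.next I ω t (history 𝒜 I w ω t)) (w t)),
     Fin.snoc (α := fun _ => Vec du) (history 𝒜 I w ω t).2
      (𝒜.next I ω t (history 𝒜 I w ω t)))

/-- The state at time `t`. -/
noncomputable def state (𝒜 : Algorithm dx du Ω S) (I : Problem dx du) (w : ℕ → Vec dx) (ω : Ω)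
    (t : ℕ) : Vec dx :=
  (𝒜.history I w ω t).1 (Fin.last t)

/-- The control at time `t`. -/
noncomputable def input (𝒜 : Algorithm dx du Ω S) (I : Problem dx du) (w : ℕ → Vec dx) (ω : Ω)
    (t : ℕ) : Vec du :=
  𝒜.next I ω t (𝒜.history I w ω t)

end Algorithm

/-- Disturbance-action controllers with parameters `(K, M)`, `M = [M⁰, …, M^{H-1}]`. -/
structure DAC (dx du : ℕ) where
  K : Matrix (Fin du) (Fin dx) ℝ
  H : ℕ
  M : Fin H → Matrix (Fin du) (Fin dx) ℝ

namespace DAC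

variable {dx du : ℕ}

/-- The control `u_t = K x_t + ∑_{i=1}^H M^{i-1} w_{t-i}` at state `x`; disturbances before the
initial time are zero. -/
noncomputable def control (π : DAC dx du) (w : ℕ → Vec dx) (t : ℕ) (x : Vec dx) : Vec du :=
  app π.K x + ∑ i : Fin π.H, app (π.M i) (if (i : ℕ) + 1 ≤ t then w (t - ((i : ℕ) + 1)) else 0)

/-- The states when the controller runs on the problem with disturbances `w`. -/
noncomputable def state (π : DAC dx du) (I : Problem dx du) (w : ℕ → Vec dx) : ℕ → Vec dx
  | 0 => I.x₁
  | t + 1 => I.step (state π I w t) (π.control w t (state π I w t)) (w t)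

/-- The control at time `t`. -/
noncomputable def input (π : DAC dx du) (I : Problem dx du) (w : ℕ → Vec dx) (t : ℕ) : Vec du :=
  π.control w t (π.state I w t)

end DAC

/-- The strongly stable linear controllers `u_t = K x_t` of a system, as disturbance-action
controllers without disturbance terms. -/
def stableLinear {dx du : ℕ} (I : Problem dx du) : Set (DAC dx du) :=
  {π | π.H = 0 ∧ ∃ κ γ : ℝ, StronglyStable I.A I.B π.K κ γ}

/-- The regret over `T` iterations, with disturbances `w`, against the comparator class `Pi`, when
the randomness of the algorithm has the value `ω`. -/
noncomputable def regret {dx du : ℕ} {Ω : Type*} [MeasurableSpace Ω] {S : ℕ → Type*}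
    [∀ t, MeasurableSpace (S t)] (𝒜 : Algorithm dx du Ω S) (I : Problem dx du) (w : ℕ → Vec dx)
    (Pi : Set (DAC dx du)) (T : ℕ) (ω : Ω) : ℝ :=
  I.totalCost T (𝒜.state I w ω) (𝒜.input I w ω) -
    sInf ((fun π : DAC dx du => I.totalCost T (π.state I w) (π.input I w)) '' Pi)

end BlackBoxControl

/-! A Gaussian system is unpredictable in every direction that has not yet been probed. Let `A = s
g` with `g` a standard Gaussian matrix, and fix the random strings. The history up to `x_t` depends
on `A` only through its values at the earlier states. If `P` is the projection off their span, then
`g P` is still fresh given that history. Write `P x_t = z q` with `‖q‖ = 1`. Then `A x_t` contains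
the fresh term `s z (g q)`, and `u_t`, chosen before this term is seen, only shifts it. A shifted
Gaussian is rarely small: `E |a + b N|^(-1/2) ≤ 5 b^(-1/2)` uniformly in `a`
(`lintegral_invSqrt_abs_affine_gaussian`). Each step uses up one dimension, so for `n < d` steps
induction gives `E ‖x‖^(-1/2) ≤ (5 s^(-1/2))^n` (`lintegral_invSqrt_traj_add_le`,
`lintegral_invSqrt_traj_le`).

For `s = 2^80` the factor is at most `2^(-32)`. By Markov and Tonelli, the state after `d / 8 - 1`
steps is below `2^d` with tiny probability over `g` and the strings jointly. Since `g` has Frobenius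
norm at most `2 d` with probability at least `1/2`, some fixed matrix of norm `O(d)` is bad for the
algorithm (`exists_matrix_traj_large`). The comparator `u = -A x` belongs to both classes and pays
at most `1 + ‖A‖²`, so the regret is exponential (`regret_ge`). -/

namespace BlackBoxControl

open ProbabilityTheory
open scoped ENNReal RealInnerProductSpace

/-! ### Negative moments of a shifted Gaussian variable -/

/-- The function `r ↦ r^{-1/2}` with value `∞` for `r ≤ 0`. -/
noncomputable def invSqrt (r : ℝ) : ℝ≥0∞ := ENNReal.ofReal r ^ (-(1 / 2) : ℝ)

lemma invSqrt_antitone : Antitone invSqrt := fun _ _ h => by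
  rw [invSqrt, invSqrt, ENNReal.rpow_neg, ENNReal.rpow_neg, ENNReal.inv_le_inv]
  exact ENNReal.rpow_le_rpow (ENNReal.ofReal_le_ofReal h) (by norm_num)

lemma measurable_invSqrt : Measurable invSqrt := invSqrt_antitone.measurable

lemma invSqrt_zero : invSqrt 0 = ∞ := by
  simp [invSqrt, ENNReal.zero_rpow_of_neg]

lemma invSqrt_one : invSqrt 1 = 1 := by
  simp [invSqrt]

lemma invSqrt_mul {a b : ℝ} (ha : 0 < a) : invSqrt (a * b) = invSqrt a * invSqrt b := by
  rcases le_or_gt b 0 with hb | hb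
  · rw [invSqrt, invSqrt, invSqrt, ENNReal.ofReal_of_nonpos hb,
      ENNReal.ofReal_of_nonpos (mul_nonpos_of_nonneg_of_nonpos ha.le hb),
      ENNReal.zero_rpow_of_neg (by norm_num), ENNReal.mul_top]
    simp
  · rw [invSqrt, ENNReal.ofReal_mul ha.le, ENNReal.mul_rpow_of_ne_top (by simp) (by simp)]
    rfl

lemma lintegral_invSqrt_Ioc : ∫⁻ y in Set.Ioc (0 : ℝ) 1, invSqrt y = 2 := by
  have hint : IntervalIntegrable (fun y : ℝ => y ^ (-(1 / 2) : ℝ)) volume 0 1 :=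
    intervalIntegral.intervalIntegrable_rpow' (by norm_num)
  have h1 : ∫ y in Set.Ioc (0 : ℝ) 1, y ^ (-(1 / 2) : ℝ) = 2 := by
    rw [← intervalIntegral.integral_of_le zero_le_one, integral_rpow (Or.inl (by norm_num))]
    norm_num
  have h2 := ofReal_integral_eq_lintegral_ofReal
    ((intervalIntegrable_iff_integrableOn_Ioc_of_le zero_le_one).1 hint)
    ((ae_restrict_mem measurableSet_Ioc).mono fun y hy => Real.rpow_nonneg hy.1.le _)
  rw [h1] at h2
  rw [show (2 : ℝ≥0∞) = ENNReal.ofReal 2 by simp, h2]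
  refine setLIntegral_congr_fun measurableSet_Ioc fun y hy => ?_
  simp only [invSqrt]
  rw [ENNReal.ofReal_rpow_of_pos hy.1]

lemma lintegral_invSqrt_abs_Icc : ∫⁻ y in Set.Icc (-1 : ℝ) 1, invSqrt |y| ≤ 4 := by
  have hpos : ∫⁻ y in Set.Ioc (0 : ℝ) 1, invSqrt |y| = 2 := by
    rw [← lintegral_invSqrt_Ioc]
    exact setLIntegral_congr_fun measurableSet_Ioc fun y hy => by
      simp only [abs_of_pos hy.1]
  have hneg : ∫⁻ y in Set.Ico (-1 : ℝ) 0, invSqrt |y| = 2 := by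
    rw [← hpos, ← (Measure.measurePreserving_neg (volume : Measure ℝ)).setLIntegral_comp_preimage
      measurableSet_Ioc (f := fun y => invSqrt |y|) (measurable_invSqrt.comp measurable_norm)]
    simp
  have hsub : Set.Icc (-1 : ℝ) 1 ⊆ (Set.Ico (-1 : ℝ) 0 ∪ Set.Ioc (0 : ℝ) 1) ∪ {0} := by
    intro y hy
    rcases lt_trichotomy y 0 with h | h | h
    · exact Or.inl (Or.inl ⟨hy.1, h⟩)
    · exact Or.inr h
    · exact Or.inl (Or.inr ⟨h, hy.2⟩)
  calc _ ≤ ∫⁻ y in (Set.Ico (-1 : ℝ) 0 ∪ Set.Ioc (0 : ℝ) 1) ∪ {0}, invSqrt |y| :=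
        lintegral_mono_set hsub
    _ ≤ (∫⁻ y in Set.Ico (-1 : ℝ) 0, invSqrt |y|) + (∫⁻ y in Set.Ioc (0 : ℝ) 1, invSqrt |y|)
        + ∫⁻ y in ({0} : Set ℝ), invSqrt |y| :=
        (lintegral_union_le _ _ _).trans (add_le_add_left (lintegral_union_le _ _ _) _)
    _ = 4 := by
        rw [hneg, hpos]
        simp
        norm_num

lemma gaussianPDF_zero_one_le (x : ℝ) : gaussianPDF 0 1 x ≤ 1 := by
  rw [gaussianPDF, gaussianPDFReal, ENNReal.ofReal_le_one]
  have h1 : (1 : ℝ) ≤ √(2 * Real.pi * ((1 : NNReal) : ℝ)) := by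
    rw [Real.one_le_sqrt, NNReal.coe_one]
    nlinarith [Real.pi_gt_three]
  refine mul_le_one₀ (inv_le_one_of_one_le₀ h1) (Real.exp_nonneg _) ?_
  rw [Real.exp_le_one_iff]
  have := sq_nonneg (x - 0)
  rw [neg_div]
  simp only [Left.neg_nonpos_iff]
  positivity

/-- Outside `[-1, 1]` the integrand is at most `1`. Inside, the Gaussian density is at most `1`, and
`|y|^(-1/2)` has Lebesgue integral at most `4`. Translation invariance of Lebesgue measure makes the
bound uniform in `a`, which is what defeats an adaptive control. -/
lemma lintegral_invSqrt_abs_add_gaussian (a : ℝ) :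
    ∫⁻ g, invSqrt |a + g| ∂(gaussianReal 0 1) ≤ 5 := by
  have hmeas : Measurable fun g : ℝ => invSqrt |a + g| :=
    measurable_invSqrt.comp (measurable_norm.comp (measurable_const_add a))
  have hmeas' : Measurable ((Set.Icc (-1 : ℝ) 1).indicator fun y => invSqrt |y|) :=
    (measurable_invSqrt.comp measurable_norm).indicator measurableSet_Icc
  have hpt : ∀ g, invSqrt |a + g| ≤
      1 + (Set.Icc (-1 : ℝ) 1).indicator (fun y => invSqrt |y|) (a + g) := by
    intro g
    by_cases h : a + g ∈ Set.Icc (-1 : ℝ) 1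
    · rw [Set.indicator_of_mem h]
      exact le_add_self
    · rw [Set.indicator_of_notMem h, add_zero, ← invSqrt_one]
      apply invSqrt_antitone
      by_contra! h'
      exact h (abs_le.1 h'.le)
  calc _ ≤ ∫⁻ g, (1 + (Set.Icc (-1 : ℝ) 1).indicator (fun y => invSqrt |y|) (a + g))
          ∂(gaussianReal 0 1) := lintegral_mono hpt
    _ = 1 + ∫⁻ g, (Set.Icc (-1 : ℝ) 1).indicator (fun y => invSqrt |y|) (a + g)
          ∂(gaussianReal 0 1) := by
        rw [lintegral_add_left measurable_const]
        simp
    _ ≤ 1 + ∫⁻ g, (Set.Icc (-1 : ℝ) 1).indicator (fun y => invSqrt |y|) (a + g) := by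
        refine add_le_add_right ?_ _
        rw [gaussianReal_of_var_ne_zero _ one_ne_zero]
        refine (lintegral_withDensity_le_lintegral_mul _ (measurable_gaussianPDF 0 1) _).trans ?_
        refine lintegral_mono fun g => ?_
        exact mul_le_of_le_one_left' (gaussianPDF_zero_one_le g)
    _ = 1 + ∫⁻ y in Set.Icc (-1 : ℝ) 1, invSqrt |y| := by
        rw [lintegral_add_left_eq_self (μ := volume)
          ((Set.Icc (-1 : ℝ) 1).indicator fun y => invSqrt |y|),
          lintegral_indicator measurableSet_Icc]
    _ ≤ 1 + 4 := by gcongr; exact lintegral_invSqrt_abs_Icc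
    _ = 5 := by norm_num

lemma lintegral_invSqrt_abs_affine_gaussian (a : ℝ) {b : ℝ} (hb : 0 < b) :
    ∫⁻ g, invSqrt |a + b * g| ∂(gaussianReal 0 1) ≤ 5 * invSqrt b := by
  have h : ∀ g, invSqrt |a + b * g| = invSqrt b * invSqrt |a / b + g| := fun g => by
    rw [← invSqrt_mul hb, ← abs_of_pos hb, ← abs_mul, abs_of_pos hb]
    congr 2
    field_simp
  simp_rw [h]
  rw [lintegral_const_mul, mul_comm]
  · gcongr
    exact lintegral_invSqrt_abs_add_gaussian _
  · exact measurable_invSqrt.comp (measurable_norm.comp (measurable_const_add _))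

/-! ### Standard Gaussian vectors -/

section Gaussian

variable {F : Type*} [NormedAddCommGroup F] [InnerProductSpace ℝ F] [FiniteDimensional ℝ F]
  [MeasurableSpace F] [BorelSpace F]

lemma stdGaussian_map_inner (e : F) (he : ‖e‖ = 1) :
    (stdGaussian F).map (fun x => ⟪e, x⟫) = gaussianReal 0 1 := by
  have h := IsGaussian.map_eq_gaussianReal (μ := stdGaussian F) (innerSL ℝ e)
  rw [variance_dual_stdGaussian, integral_strongDual_stdGaussian, innerSL_apply_norm, he] at h
  simpa using h

/-- If `‖R v‖² = ‖R₁ v‖² + ‖R₂ v‖²` for symmetric `R, R₁, R₂` and `X, Y` are independent standard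
Gaussian vectors, then `R X` and `R₁ X + R₂ Y` have the same law. -/
lemma stdGaussian_map_eq_map_add (R R₁ R₂ : F →L[ℝ] F)
    (hR : (R : F →ₗ[ℝ] F).IsSymmetric) (hR₁ : (R₁ : F →ₗ[ℝ] F).IsSymmetric)
    (hR₂ : (R₂ : F →ₗ[ℝ] F).IsSymmetric)
    (h : ∀ v, ‖R v‖ ^ 2 = ‖R₁ v‖ ^ 2 + ‖R₂ v‖ ^ 2) :
    (stdGaussian F).map R =
      ((stdGaussian F).prod (stdGaussian F)).map (fun p => R₁ p.2 + R₂ p.1) := by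
  -- By symmetry, the characteristic function of `Q X` at `v` is that of `X` at `Q v`.
  have key : ∀ (Q : F →L[ℝ] F), (Q : F →ₗ[ℝ] F).IsSymmetric → ∀ v,
      ∫ x, Complex.exp (⟪Q x, v⟫ * Complex.I) ∂(stdGaussian F) =
        Complex.exp (-(‖Q v‖ ^ 2 / 2 : ℂ)) := by
    intro Q hQ v
    have := charFun_stdGaussian (Q v)
    rw [charFun_apply] at this
    rw [← neg_div]
    rw [← this]
    refine integral_congr_ae (.of_forall fun x => ?_)
    have := hQ x v
    simp only [ContinuousLinearMap.coe_coe] at this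
    simp only [this]
  have : IsFiniteMeasure ((stdGaussian F).map R) := Measure.isFiniteMeasure_map _ _
  have : IsFiniteMeasure (((stdGaussian F).prod (stdGaussian F)).map
    (fun p => R₁ p.2 + R₂ p.1)) := Measure.isFiniteMeasure_map _ _
  apply Measure.ext_of_charFun
  ext v
  rw [charFun_apply, charFun_apply, integral_map (by fun_prop) (by fun_prop),
    integral_map (by fun_prop) (by fun_prop), key R hR]
  have hs : ∀ p : F × F, Complex.exp (⟪R₁ p.2 + R₂ p.1, v⟫ * Complex.I) =
      Complex.exp (⟪R₂ p.1, v⟫ * Complex.I) * Complex.exp (⟪R₁ p.2, v⟫ * Complex.I) := by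
    intro p
    rw [inner_add_left, ← Complex.exp_add]
    push_cast
    ring_nf
  simp_rw [hs]
  rw [integral_prod_mul (fun x => Complex.exp (⟪R₂ x, v⟫ * Complex.I))
    (fun x => Complex.exp (⟪R₁ x, v⟫ * Complex.I)), key R₁ hR₁, key R₂ hR₂, ← Complex.exp_add]
  have hv : (‖R v‖ ^ 2 : ℂ) = ‖R₁ v‖ ^ 2 + ‖R₂ v‖ ^ 2 := by exact_mod_cast h v
  rw [hv]
  ring_nf

lemma lintegral_norm_sq_stdGaussian :
    ∫⁻ x, ENNReal.ofReal (‖x‖ ^ 2) ∂(stdGaussian F) = Module.finrank ℝ F := by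
  set b := stdOrthonormalBasis ℝ F
  have h1 : ∀ i, ∫⁻ x, ENNReal.ofReal (⟪b i, x⟫ ^ 2) ∂(stdGaussian F) = 1 := by
    intro i
    have := stdGaussian_map_inner (b i) (b.orthonormal.1 i)
    rw [← lintegral_map (f := fun y : ℝ => ENNReal.ofReal (y ^ 2)) (g := fun x => ⟪b i, x⟫)
      (by fun_prop) (by fun_prop), this, ← ofReal_integral_eq_lintegral_ofReal]
    · have hv := variance_fun_id_gaussianReal (μ := 0) (v := 1)
      rw [variance_eq_integral (by fun_prop)] at hv
      simp only [integral_id_gaussianReal, sub_zero] at hv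
      rw [hv]
      simp
    · exact (memLp_id_gaussianReal 2).integrable_sq
    · exact .of_forall fun x => sq_nonneg _
  have h2 : ∀ x : F, ENNReal.ofReal (‖x‖ ^ 2) = ∑ i, ENNReal.ofReal (⟪b i, x⟫ ^ 2) := by
    intro x
    rw [← ENNReal.ofReal_sum_of_nonneg fun i _ => sq_nonneg _, b.sum_sq_inner_right]
  simp_rw [h2]
  rw [lintegral_finsetSum _ fun i _ => by fun_prop]
  simp [h1]

end Gaussian

/-! ### Projections and Gaussian matrices -/

section Matrices

variable {d : ℕ}

lemma app_add {m n : ℕ} (A B : Matrix (Fin m) (Fin n) ℝ) (x : Vec n) :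
    app (A + B) x = app A x + app B x := by
  simp [app, Matrix.add_mulVec]

lemma app_smul {m n : ℕ} (s : ℝ) (A : Matrix (Fin m) (Fin n) ℝ) (x : Vec n) :
    app (s • A) x = s • app A x := by
  simp [app, Matrix.smul_mulVec]

lemma app_sub {m n : ℕ} (A B : Matrix (Fin m) (Fin n) ℝ) (x : Vec n) :
    app (A - B) x = app A x - app B x := by
  simp [app, Matrix.sub_mulVec]

lemma app_neg {m n : ℕ} (A : Matrix (Fin m) (Fin n) ℝ) (x : Vec n) :
    app (-A) x = -app A x := by
  simp [app, Matrix.neg_mulVec]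

lemma app_zero {m n : ℕ} (A : Matrix (Fin m) (Fin n) ℝ) : app A 0 = 0 := by
  simp [app]

lemma app_vec_smul {m n : ℕ} (s : ℝ) (A : Matrix (Fin m) (Fin n) ℝ) (x : Vec n) :
    app A (s • x) = s • app A x := by
  simp [app, Matrix.mulVec_smul]

lemma app_one (x : Vec d) : app 1 x = x := by
  simp [app]

lemma app_mul {l m n : ℕ} (A : Matrix (Fin l) (Fin m) ℝ) (B : Matrix (Fin m) (Fin n) ℝ)
    (x : Vec n) : app (A * B) x = app A (app B x) := by
  simp [app, Matrix.mulVec_mulVec]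

lemma inner_eq_dotProduct (x y : Vec d) : ⟪x, y⟫ = x.ofLp ⬝ᵥ y.ofLp := by
  simp [PiLp.inner_apply, dotProduct, mul_comm]

lemma inner_app_of_symm {P : Matrix (Fin d) (Fin d) ℝ} (hP : Pᵀ = P) (x y : Vec d) :
    ⟪app P x, y⟫ = ⟪x, app P y⟫ := by
  rw [inner_eq_dotProduct, inner_eq_dotProduct, app, app, dotProduct_comm,
    Matrix.dotProduct_mulVec, ← Matrix.mulVec_transpose, hP, dotProduct_comm]

/-- The orthogonal projection to the line of a unit vector. -/
def lineProj (q : Vec d) : Matrix (Fin d) (Fin d) ℝ := Matrix.vecMulVec q.ofLp q.ofLp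

lemma app_lineProj (q x : Vec d) : app (lineProj q) x = ⟪q, x⟫ • q := by
  ext i
  simp [app, lineProj, Matrix.vecMulVec_mulVec, inner_eq_dotProduct]

lemma transpose_lineProj (q : Vec d) : (lineProj q)ᵀ = lineProj q := by
  simp [lineProj, Matrix.transpose_vecMulVec]

lemma trace_lineProj {q : Vec d} (hq : ‖q‖ = 1) : (lineProj q).trace = 1 := by
  rw [lineProj, Matrix.trace_vecMulVec, ← inner_eq_dotProduct, real_inner_self_eq_norm_sq, hq]
  norm_num

lemma matrix_ext_app {A B : Matrix (Fin d) (Fin d) ℝ} (h : ∀ x, app A x = app B x) : A = B := by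
  apply Matrix.mulVec_injective
  funext v
  exact congrArg WithLp.ofLp (h (WithLp.toLp 2 v))

lemma lineProj_mul_self {q : Vec d} (hq : ‖q‖ = 1) : lineProj q * lineProj q = lineProj q := by
  apply matrix_ext_app
  intro x
  rw [app_mul, app_lineProj q x, app_vec_smul, app_lineProj, real_inner_self_eq_norm_sq, hq]
  simp

lemma sub_lineProj_mul_self {P : Matrix (Fin d) (Fin d) ℝ} (hPt : Pᵀ = P) (hP : P * P = P)
    {q : Vec d} (hq : ‖q‖ = 1) (hPq : app P q = q) :
    (P - lineProj q) * (P - lineProj q) = P - lineProj q := by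
  have hPP : ∀ x, app P (app P x) = app P x := fun x => by rw [← app_mul, hP]
  have hqP : ∀ x, ⟪q, app P x⟫ = ⟪q, x⟫ := fun x => by rw [← inner_app_of_symm hPt, hPq]
  have hself : ∀ x, app (lineProj q) (app (lineProj q) x) = app (lineProj q) x := fun x => by
    rw [← app_mul, lineProj_mul_self hq]
  apply matrix_ext_app
  intro x
  rw [app_mul, app_sub P _ x, app_sub, sub_eq_add_neg (app P x)]
  simp only [app_lineProj, ← sub_eq_add_neg]
  have h1 : app P (app P x - ⟪q, x⟫ • q) = app P x - ⟪q, x⟫ • q := by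
    rw [sub_eq_add_neg, ← neg_smul]
    have : app P (app P x + (-⟪q, x⟫) • q) = app P (app P x) + app P ((-⟪q, x⟫) • q) := by
      simp [app, Matrix.mulVec_add]
    rw [this, hPP, app_vec_smul, hPq]
  rw [h1, inner_sub_right, hqP, inner_smul_right, real_inner_self_eq_norm_sq, hq]
  simp

/-- The space of `d × d` matrices with the Frobenius inner product. -/
abbrev MatVec (d : ℕ) : Type := EuclideanSpace ℝ (Fin d × Fin d)

/-- The matrix with given entries. -/
def toMat (g : MatVec d) : Matrix (Fin d) (Fin d) ℝ := Matrix.of fun i j => g (i, j)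

/-- Right multiplication by a matrix. -/
noncomputable def mulRight (P : Matrix (Fin d) (Fin d) ℝ) : MatVec d →L[ℝ] MatVec d :=
  LinearMap.toContinuousLinearMap
    { toFun := fun g => WithLp.toLp 2 fun p => (toMat g * P) p.1 p.2
      map_add' := fun g h => by
        ext p
        simp [toMat, Matrix.mul_apply, add_mul, Finset.sum_add_distrib]
      map_smul' := fun c g => by
        ext p
        simp [toMat, Matrix.mul_apply, mul_assoc, Finset.mul_sum] }

lemma toMat_mulRight (P : Matrix (Fin d) (Fin d) ℝ) (g : MatVec d) :
    toMat (mulRight P g) = toMat g * P := rfl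

lemma toMat_add (g h : MatVec d) : toMat (g + h) = toMat g + toMat h := rfl

lemma inner_eq_trace (g h : MatVec d) : ⟪g, h⟫ = (toMat g * (toMat h)ᵀ).trace := by
  simp [PiLp.inner_apply, Matrix.trace, Matrix.mul_apply, toMat, Fintype.sum_prod_type, mul_comm]

lemma mulRight_isSymmetric {P : Matrix (Fin d) (Fin d) ℝ} (hP : Pᵀ = P) :
    (mulRight P : MatVec d →ₗ[ℝ] MatVec d).IsSymmetric := by
  intro g h
  rw [ContinuousLinearMap.coe_coe, inner_eq_trace, inner_eq_trace, toMat_mulRight, toMat_mulRight,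
    Matrix.transpose_mul, hP, Matrix.mul_assoc]

lemma norm_sq_mulRight {P : Matrix (Fin d) (Fin d) ℝ} (hPt : Pᵀ = P) (hP : P * P = P)
    (g : MatVec d) : ‖mulRight P g‖ ^ 2 = (toMat g * P * (toMat g)ᵀ).trace := by
  rw [← real_inner_self_eq_norm_sq, inner_eq_trace, toMat_mulRight, Matrix.transpose_mul, hPt,
    ← Matrix.mul_assoc, Matrix.mul_assoc (toMat g) P P, hP]

/-- The matrices `P - lineProj q` and `lineProj q` are projections with sum `P`, so the Frobenius
norms of the two parts of `g P` add in squares. Hence the action of the Gaussian matrix on `q` can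
be drawn separately, as `h`, from its action on the rest of the range of `P`. -/
lemma lintegral_mulRight_split {P : Matrix (Fin d) (Fin d) ℝ} (hPt : Pᵀ = P) (hP : P * P = P)
    {q : Vec d} (hq : ‖q‖ = 1) (hPq : app P q = q) {f : MatVec d → ℝ≥0∞} (hf : Measurable f) :
    ∫⁻ g, f (mulRight P g) ∂(stdGaussian (MatVec d)) =
      ∫⁻ h, ∫⁻ g, f (mulRight (P - lineProj q) g + mulRight (lineProj q) h)
        ∂(stdGaussian (MatVec d)) ∂(stdGaussian (MatVec d)) := by
  have hPt' : (P - lineProj q)ᵀ = P - lineProj q := by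
    rw [Matrix.transpose_sub, hPt, transpose_lineProj]
  have hlaw := stdGaussian_map_eq_map_add (mulRight P) (mulRight (P - lineProj q))
    (mulRight (lineProj q)) (mulRight_isSymmetric hPt) (mulRight_isSymmetric hPt')
    (mulRight_isSymmetric (transpose_lineProj q)) (fun v => by
      rw [norm_sq_mulRight hPt hP, norm_sq_mulRight hPt' (sub_lineProj_mul_self hPt hP hq hPq),
        norm_sq_mulRight (transpose_lineProj q) (lineProj_mul_self hq), ← Matrix.trace_add,
        ← Matrix.add_mul, ← Matrix.mul_add, sub_add_cancel])
  rw [← lintegral_map hf (by fun_prop), hlaw, lintegral_map hf (by fun_prop), lintegral_prod]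
  exact (hf.comp (by fun_prop)).aemeasurable

/-- The rank-one matrix `n qᵀ`. -/
noncomputable def rankOne (n q : Vec d) : MatVec d := WithLp.toLp 2 fun p => n p.1 * q p.2

lemma norm_rankOne (n q : Vec d) : ‖rankOne n q‖ = ‖n‖ * ‖q‖ := by
  rw [← sq_eq_sq₀ (norm_nonneg _) (by positivity), mul_pow, EuclideanSpace.real_norm_sq_eq,
    EuclideanSpace.real_norm_sq_eq, EuclideanSpace.real_norm_sq_eq, Fintype.sum_prod_type,
    Finset.sum_mul_sum]
  simp [rankOne, mul_pow]

/-- This exhibits `nᵀ G q` as a coordinate of `G` along a matrix of Frobenius norm `‖n‖ ‖q‖`, hence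
as a standard Gaussian variable when `n` and `q` are unit vectors. -/
lemma inner_app_toMat (n q : Vec d) (g : MatVec d) :
    ⟪n, app (toMat g) q⟫ = ⟪rankOne n q, g⟫ := by
  simp only [PiLp.inner_apply, app, toMat, rankOne, Matrix.mulVec, dotProduct,
    Fintype.sum_prod_type, Matrix.of_apply, RCLike.inner_apply, conj_trivial, Finset.sum_mul]
  exact Finset.sum_congr rfl fun i _ => Finset.sum_congr rfl fun j _ => by ring

lemma norm_app_le {m n : ℕ} (A : Matrix (Fin m) (Fin n) ℝ) (x : Vec n) :
    ‖app A x‖ ≤ ‖A‖ * ‖x‖ :=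
  A.l2_opNorm_mulVec x

lemma opNorm_le_of_app {m n : ℕ} (A : Matrix (Fin m) (Fin n) ℝ) {c : ℝ} (hc : 0 ≤ c)
    (h : ∀ x, ‖app A x‖ ≤ c * ‖x‖) : ‖A‖ ≤ c := by
  rw [Matrix.l2_opNorm_def]
  exact ContinuousLinearMap.opNorm_le_bound _ hc h

lemma opNorm_toMat_le (g : MatVec d) : ‖toMat g‖ ≤ ‖g‖ := by
  refine opNorm_le_of_app _ (norm_nonneg _) fun x => ?_
  have h : ⟪app (toMat g) x, app (toMat g) x⟫ ≤ ‖app (toMat g) x‖ * ‖x‖ * ‖g‖ := by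
    rw [inner_app_toMat, ← norm_rankOne]
    exact real_inner_le_norm _ _
  rw [real_inner_self_eq_norm_sq] at h
  rcases (norm_nonneg (app (toMat g) x)).eq_or_lt with h0 | h0
  · rw [← h0]; positivity
  · nlinarith

lemma norm_app_of_proj_le {P : Matrix (Fin d) (Fin d) ℝ} (hPt : Pᵀ = P) (hP : P * P = P)
    (x : Vec d) : ‖app P x‖ ≤ ‖x‖ := by
  have h : ‖app P x‖ ^ 2 ≤ ‖x‖ * ‖app P x‖ := by
    rw [← real_inner_self_eq_norm_sq, inner_app_of_symm hPt, ← app_mul, hP]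
    exact real_inner_le_norm _ _
  rcases (norm_nonneg (app P x)).eq_or_lt with h0 | h0
  · rw [← h0]; positivity
  · nlinarith

/-- The trace of a projection stands in for its rank: it drops by exactly one with each line
removed. -/
lemma exists_unit_vector_of_trace_pos {P : Matrix (Fin d) (Fin d) ℝ} (hP : P * P = P)
    (htr : 0 < P.trace) : ∃ n : Vec d, ‖n‖ = 1 ∧ app P n = n := by
  obtain ⟨x, hx⟩ : ∃ x, app P x ≠ 0 := by
    by_contra! h
    have : P = 0 := matrix_ext_app fun x => by rw [h x]; simp [app]
    simp [this] at htr
  refine ⟨‖app P x‖⁻¹ • app P x, ?_, ?_⟩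
  · rw [norm_smul, norm_inv, norm_norm, inv_mul_cancel₀ (norm_ne_zero_iff.2 hx)]
  · rw [app_vec_smul, ← app_mul, hP]

end Matrices

/-! ### Runs of the algorithm on a random system -/

section Trajectories

variable {d : ℕ}

/-- The noiseless control problem `x_{t+1} = A x_t + u_t`, `x_1 = e_1`, with costs
`‖x‖² + ‖u‖²`. -/
noncomputable def quadProblem (A : Matrix (Fin d) (Fin d) ℝ) : Problem d d where
  A := A
  B := 1
  x₁ := e1 d
  cost := fun _ x u => ‖x‖ ^ 2 + ‖u‖ ^ 2
  convex_cost := fun _ => by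
    have h := (convexOn_univ_norm (E := Vec d)).pow (fun _ _ => norm_nonneg _) 2
    exact (h.comp_linearMap (LinearMap.fst ℝ (Vec d) (Vec d))).add
      (h.comp_linearMap (LinearMap.snd ℝ (Vec d) (Vec d)))

variable {Ω : Type*} [MeasurableSpace Ω] {S : ℕ → Type*} [∀ t, MeasurableSpace (S t)]
  (𝒜 : Algorithm d d Ω S)

/-- The states when the algorithm runs on `quadProblem A`, without disturbances. -/
noncomputable def traj (ω : Ω) (A : Matrix (Fin d) (Fin d) ℝ) (t : ℕ) : Vec d :=
  𝒜.state (quadProblem A) 0 ω t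

lemma traj_zero (ω : Ω) (A : Matrix (Fin d) (Fin d) ℝ) : traj 𝒜 ω A 0 = e1 d := rfl

lemma traj_succ (ω : Ω) (A : Matrix (Fin d) (Fin d) ℝ) (t : ℕ) :
    traj 𝒜 ω A (t + 1) = app A (traj 𝒜 ω A t) + 𝒜.input (quadProblem A) 0 ω t := by
  simp only [traj, Algorithm.state, Algorithm.history, Fin.snoc_last, Problem.step, quadProblem,
    app_one, Pi.zero_apply, add_zero]
  rfl

/-- The history at time `t` depends only on the values of `A` at the earlier states. -/
lemma history_congr (ω : Ω) {A A' : Matrix (Fin d) (Fin d) ℝ} :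
    ∀ t, (∀ j < t, app A (traj 𝒜 ω A j) = app A' (traj 𝒜 ω A j)) →
      𝒜.history (quadProblem A) 0 ω t = 𝒜.history (quadProblem A') 0 ω t
  | 0, _ => rfl
  | t + 1, h => by
    have ih := history_congr ω t fun j hj => h j (hj.trans (Nat.lt_succ_self t))
    have ht := h t (Nat.lt_succ_self t)
    have hn : 𝒜.next (quadProblem A) ω t = 𝒜.next (quadProblem A') ω t := rfl
    simp only [traj, Algorithm.state] at ht
    simp only [Algorithm.history, Problem.step]
    rw [show (quadProblem A).A = A from rfl, ht, hn, ih]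
    rfl

lemma traj_congr (ω : Ω) {A A' : Matrix (Fin d) (Fin d) ℝ} {t : ℕ}
    (h : ∀ j < t, app A (traj 𝒜 ω A j) = app A' (traj 𝒜 ω A j)) :
    traj 𝒜 ω A' t = traj 𝒜 ω A t := by
  rw [traj, traj, Algorithm.state, Algorithm.state, history_congr 𝒜 ω t h]

lemma input_congr (ω : Ω) {A A' : Matrix (Fin d) (Fin d) ℝ} {t : ℕ}
    (h : ∀ j < t, app A (traj 𝒜 ω A j) = app A' (traj 𝒜 ω A j)) :
    𝒜.input (quadProblem A') 0 ω t = 𝒜.input (quadProblem A) 0 ω t := by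
  rw [Algorithm.input, Algorithm.input, history_congr 𝒜 ω t h]
  rfl

lemma measurable_app_toMat {α : Type*} [MeasurableSpace α] {M : α → MatVec d} (hM : Measurable M)
    {x : α → Vec d} (hx : Measurable x) : Measurable fun a => app (toMat (M a)) (x a) := by
  refine (WithLp.measurable_toLp 2 _).comp (measurable_pi_lambda _ fun i => ?_)
  simp only [Matrix.mulVec, dotProduct, toMat, Matrix.of_apply]
  fun_prop

/-- Joint measurability in the matrix and the random strings is needed for Tonelli. The cost
functions are the same for all matrices, so measurability of the control for fixed costs suffices.
-/
lemma measurable_history {α : Type*} [MeasurableSpace α] {M : α → MatVec d} (hM : Measurable M)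
    {τ : α → Ω} (hτ : Measurable τ) (t : ℕ) :
    Measurable fun a => 𝒜.history (quadProblem (toMat (M a))) 0 (τ a) t := by
  induction t with
  | zero =>
    simp only [Algorithm.history, quadProblem]
    exact measurable_const
  | succ t ih =>
    have hu : Measurable fun a => 𝒜.next (quadProblem (toMat (M a))) (τ a) t
        (𝒜.history (quadProblem (toMat (M a))) 0 (τ a) t) :=
      (𝒜.measurable_control t fun _ x u => ‖x‖ ^ 2 + ‖u‖ ^ 2).comp
        (ih.fst.prodMk (ih.snd.prodMk ((𝒜.measurable_σ t).comp hτ)))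
    have hx : Measurable fun a => (𝒜.history (quadProblem (toMat (M a))) 0 (τ a) t).1
        (Fin.last t) := (measurable_pi_apply _).comp ih.fst
    refine Measurable.prodMk ?_ ?_
    · refine measurable_pi_lambda _ fun i => ?_
      refine Fin.lastCases ?_ (fun j => ?_) i
      · simp only [Fin.snoc_last, Problem.step, quadProblem, app_one,
          Pi.zero_apply, add_zero]
        exact (measurable_app_toMat hM hx).add hu
      · simp only [Fin.snoc_castSucc]
        exact (measurable_pi_apply _).comp ih.fst
    · refine measurable_pi_lambda _ fun i => ?_
      refine Fin.lastCases ?_ (fun j => ?_) i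
      · simp only [Fin.snoc_last]
        exact hu
      · simp only [Fin.snoc_castSucc]
        exact (measurable_pi_apply _).comp ih.snd

lemma measurable_traj {α : Type*} [MeasurableSpace α] {M : α → MatVec d} (hM : Measurable M)
    {τ : α → Ω} (hτ : Measurable τ) (t : ℕ) :
    Measurable fun a => traj 𝒜 (τ a) (toMat (M a)) t := by
  simp only [traj, Algorithm.state]
  exact (measurable_pi_apply _).comp (measurable_history 𝒜 hM hτ t).fst

/-- Along a run of the algorithm, the component of the next state outside the span of the past
states is bounded below in terms of the previous one, in the mean. -/
lemma lintegral_invSqrt_proj_step (ω : Ω) {s : ℝ} (hs : 0 < s) {t : ℕ} {a : MatVec d}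
    {P' : Matrix (Fin d) (Fin d) ℝ} (hPt : P'ᵀ = P') (hP : P' * P' = P') (htr : 0 < P'.trace)
    {q : Vec d} (hq : ‖q‖ = 1) {z : ℝ} (hz : 0 < z) (hqt : ⟪q, traj 𝒜 ω (toMat a) t⟫ = z)
    (hqj : ∀ j < t, ⟪q, traj 𝒜 ω (toMat a) j⟫ = 0) :
    ∫⁻ h, invSqrt ‖app P' (traj 𝒜 ω (toMat (a + s • mulRight (lineProj q) h)) (t + 1))‖
      ∂(stdGaussian (MatVec d)) ≤ 5 * invSqrt s * invSqrt z := by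
  obtain ⟨n, hn, hPn⟩ := exists_unit_vector_of_trace_pos hP htr
  have happ : ∀ (h : MatVec d) (x : Vec d), app (toMat (a + s • mulRight (lineProj q) h)) x =
      app (toMat a) x + s • ⟪q, x⟫ • app (toMat h) q := fun h x => by
    rw [toMat_add, app_add, show toMat (s • mulRight (lineProj q) h) =
      s • (toMat h * lineProj q) from rfl, app_smul, app_mul, app_lineProj, app_vec_smul]
  -- Changing `h` alters the system only along `q`, which is orthogonal to all states before `t`. So
  -- `x_t` and `u_t` do not depend on `h`.
  have hc : ∀ h : MatVec d, ∀ j < t, app (toMat a) (traj 𝒜 ω (toMat a) j) =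
      app (toMat (a + s • mulRight (lineProj q) h)) (traj 𝒜 ω (toMat a) j) := fun h j hj => by
    rw [happ, hqj j hj]
    simp
  set x := traj 𝒜 ω (toMat a) t
  -- `b` collects everything independent of `h`, including the control. The component of the next
  -- state along `n` is then `b + s z N` with `N` standard Gaussian.
  set b : ℝ := ⟪n, app (toMat a) x + 𝒜.input (quadProblem (toMat a)) 0 ω t⟫ with hb
  have hle : ∀ h : MatVec d,
      invSqrt ‖app P' (traj 𝒜 ω (toMat (a + s • mulRight (lineProj q) h)) (t + 1))‖ ≤
        invSqrt |b + s * z * ⟪rankOne n q, h⟫| := fun h => by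
    apply invSqrt_antitone
    have h1 : b + s * z * ⟪rankOne n q, h⟫ =
        ⟪n, app P' (traj 𝒜 ω (toMat (a + s • mulRight (lineProj q) h)) (t + 1))⟫ := by
      rw [← inner_app_of_symm hPt, hPn, traj_succ, traj_congr 𝒜 ω (hc h), input_congr 𝒜 ω (hc h),
        happ, hqt, add_right_comm, inner_add_right, ← hb, inner_smul_right, inner_smul_right,
        inner_app_toMat]
      ring
    rw [h1]
    simpa [hn] using abs_real_inner_le_norm n
      (app P' (traj 𝒜 ω (toMat (a + s • mulRight (lineProj q) h)) (t + 1)))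
  refine (lintegral_mono hle).trans ?_
  have hlaw := stdGaussian_map_inner (rankOne n q) (by rw [norm_rankOne, hn, hq, one_mul])
  have hmeas : Measurable fun r : ℝ => invSqrt |b + s * z * r| :=
    measurable_invSqrt.comp (by fun_prop)
  rw [← lintegral_map (f := fun r : ℝ => invSqrt |b + s * z * r|)
    (g := fun h : MatVec d => ⟪rankOne n q, h⟫) hmeas (by fun_prop), hlaw, mul_assoc,
    ← invSqrt_mul hs]
  exact lintegral_invSqrt_abs_affine_gaussian b (mul_pos hs hz)

/-- The part `a` of the system is already revealed and the part `s g P` is still random. As `P`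
kills the states before `t`, the run up to `x_t` is deterministic. One step reveals the action on
the direction `q` of `P x_t`, moves it into `a`, and replaces `P` by `P - lineProj q`. The trace
condition keeps enough fresh directions for the `n` steps that remain. -/
lemma lintegral_invSqrt_traj_add_le (ω : Ω) {s : ℝ} (hs : 0 < s) (n : ℕ) :
    ∀ (t : ℕ) (a : MatVec d) (P : Matrix (Fin d) (Fin d) ℝ), Pᵀ = P → P * P = P →
      (n : ℝ) < P.trace → (∀ j < t, app P (traj 𝒜 ω (toMat a) j) = 0) →
      ∫⁻ g, invSqrt ‖traj 𝒜 ω (toMat (a + s • mulRight P g)) (t + n)‖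
        ∂(stdGaussian (MatVec d)) ≤
      (5 * invSqrt s) ^ n * invSqrt ‖app P (traj 𝒜 ω (toMat a) t)‖ := by
  induction n with
  | zero =>
    intro t a P hPt hP _ hj
    have hc : ∀ g : MatVec d, ∀ j < t, app (toMat a) (traj 𝒜 ω (toMat a) j) =
        app (toMat (a + s • mulRight P g)) (traj 𝒜 ω (toMat a) j) := fun g j hjt => by
      rw [toMat_add, app_add, show toMat (s • mulRight P g) = s • (toMat g * P) from rfl,
        app_smul, app_mul, hj j hjt, app_zero, smul_zero, add_zero]
    simp_rw [add_zero, traj_congr 𝒜 ω (hc _)]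
    rw [lintegral_const, measure_univ, mul_one, pow_zero, one_mul]
    exact invSqrt_antitone (norm_app_of_proj_le hPt hP _)
  | succ n ih =>
    intro t a P hPt hP htr hj
    set x := traj 𝒜 ω (toMat a) t with hx
    -- If `x_t` has no fresh component, the right-hand side is `∞`.
    rcases (norm_nonneg (app P x)).eq_or_lt with hz | hz
    · rw [← hz, invSqrt_zero, ENNReal.mul_top]
      · exact le_top
      · refine pow_ne_zero _ (mul_ne_zero (by norm_num) ?_)
        simp [invSqrt]
    set z := ‖app P x‖ with hzd
    set q : Vec d := z⁻¹ • app P x with hqd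
    have hq : ‖q‖ = 1 := by
      rw [hqd, norm_smul, norm_inv, Real.norm_of_nonneg hz.le, ← hzd, inv_mul_cancel₀ hz.ne']
    have hPq : app P q = q := by rw [hqd, app_vec_smul, ← app_mul, hP]
    have hqin : ∀ y, ⟪q, y⟫ = z⁻¹ * ⟪x, app P y⟫ := fun y => by
      rw [hqd, real_inner_smul_left, inner_app_of_symm hPt]
    have hqx : ⟪q, x⟫ = z := by
      rw [hqin, ← hP, app_mul, ← inner_app_of_symm hPt, real_inner_self_eq_norm_sq, ← hzd]
      field_simp
    have hqj : ∀ j < t, ⟪q, traj 𝒜 ω (toMat a) j⟫ = 0 := fun j hjt => by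
      rw [hqin, hj j hjt, inner_zero_right, mul_zero]
    set P' := P - lineProj q with hP'
    have hPt' : P'ᵀ = P' := by rw [hP', Matrix.transpose_sub, hPt, transpose_lineProj]
    have hPP' : P' * P' = P' := sub_lineProj_mul_self hPt hP hq hPq
    have htr' : (n : ℝ) < P'.trace := by
      rw [hP', Matrix.trace_sub, trace_lineProj hq]
      push_cast at htr
      linarith
    have hP'j : ∀ j < t + 1, app P' (traj 𝒜 ω (toMat a) j) = 0 := fun j hjt => by
      rw [hP', app_sub, app_lineProj]
      rcases Nat.lt_succ_iff_lt_or_eq.1 hjt with h | rfl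
      · rw [hj j h, hqj j h]; simp
      · rw [← hx, hqx, hqd, smul_smul, mul_inv_cancel₀ hz.ne', one_smul, sub_self]
    have hmeas : Measurable fun g : MatVec d =>
        invSqrt ‖traj 𝒜 ω (toMat (a + s • g)) (t + (n + 1))‖ :=
      measurable_invSqrt.comp (measurable_norm.comp
        (measurable_traj 𝒜 (by fun_prop) measurable_const _))
    rw [lintegral_mulRight_split hPt hP hq hPq hmeas]
    have hinner : ∀ h : MatVec d,
        ∫⁻ g, invSqrt ‖traj 𝒜 ω (toMat (a + s • (mulRight (P - lineProj q) g +
          mulRight (lineProj q) h))) (t + (n + 1))‖ ∂(stdGaussian (MatVec d)) ≤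
        (5 * invSqrt s) ^ n *
          invSqrt ‖app P' (traj 𝒜 ω (toMat (a + s • mulRight (lineProj q) h)) (t + 1))‖ := by
      intro h
      have hc : ∀ j < t, app (toMat a) (traj 𝒜 ω (toMat a) j) =
          app (toMat (a + s • mulRight (lineProj q) h)) (traj 𝒜 ω (toMat a) j) := fun j hjt => by
        rw [toMat_add, app_add, show toMat (s • mulRight (lineProj q) h) =
          s • (toMat h * lineProj q) from rfl, app_smul, app_mul, app_lineProj, hqj j hjt,
          zero_smul, app_zero, smul_zero, add_zero]
      -- The induction hypothesis is applied with `h` frozen, so that the randomness left is that of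
      -- `g`.
      have := ih (t + 1) (a + s • mulRight (lineProj q) h) P' hPt' hPP' htr' fun j hjt => by
        rw [traj_congr 𝒜 ω fun i hi => hc i (hi.trans_le (Nat.lt_succ_iff.1 hjt)), hP'j j hjt]
      simpa only [smul_add, add_assoc, add_comm, add_left_comm] using this
    calc _ ≤ ∫⁻ h, (5 * invSqrt s) ^ n *
          invSqrt ‖app P' (traj 𝒜 ω (toMat (a + s • mulRight (lineProj q) h)) (t + 1))‖
          ∂(stdGaussian (MatVec d)) := lintegral_mono hinner
      _ = (5 * invSqrt s) ^ n * ∫⁻ h,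
          invSqrt ‖app P' (traj 𝒜 ω (toMat (a + s • mulRight (lineProj q) h)) (t + 1))‖
          ∂(stdGaussian (MatVec d)) := by
          rw [lintegral_const_mul]
          have h1 : Measurable fun h : MatVec d =>
              traj 𝒜 ω (toMat (a + s • mulRight (lineProj q) h)) (t + 1) :=
            measurable_traj 𝒜 (by fun_prop) measurable_const _
          refine measurable_invSqrt.comp (measurable_norm.comp ?_)
          exact ((LinearMap.toContinuousLinearMap (Matrix.toEuclideanLin P')).measurable).comp h1
      _ ≤ (5 * invSqrt s) ^ n * (5 * invSqrt s * invSqrt z) := by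
          gcongr
          exact lintegral_invSqrt_proj_step 𝒜 ω hs hPt' hPP'
            ((Nat.cast_nonneg n).trans_lt htr') hq hz hqx hqj
      _ = _ := by rw [pow_succ, ← mul_assoc]

lemma norm_e1 (hd : 0 < d) : ‖e1 d‖ = 1 := by
  have : e1 d = EuclideanSpace.single (⟨0, hd⟩ : Fin d) (1 : ℝ) := by
    ext i
    simp [e1, Fin.ext_iff]
  rw [this]
  simp

lemma lintegral_invSqrt_traj_le (ω : Ω) {s : ℝ} (hs : 0 < s) {n : ℕ} (hn : n < d) :
    ∫⁻ g, invSqrt ‖traj 𝒜 ω (toMat (s • g)) n‖ ∂(stdGaussian (MatVec d)) ≤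
      (5 * invSqrt s) ^ n := by
  have h := lintegral_invSqrt_traj_add_le 𝒜 ω hs n 0 0 1 (by simp) (by simp)
    (by simpa using hn) (by simp)
  have h1 : ∀ g : MatVec d, mulRight 1 g = g := fun g => by
    ext p
    simp [mulRight, toMat]
  simpa [h1, app_one, traj_zero, norm_e1 (Nat.zero_lt_of_lt hn), invSqrt_one] using h

end Trajectories

/-! ### From the average over Gaussian systems to one bad system -/

variable {d : ℕ}

/-- Markov's inequality for `‖g‖²`, whose mean is `d²`. -/
lemma stdGaussian_norm_le_ge (hd : 0 < d) :
    1 / 2 ≤ stdGaussian (MatVec d) {g | ‖g‖ ≤ 2 * d} := by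
  have hms : MeasurableSet {g : MatVec d | ‖g‖ ≤ 2 * d} :=
    measurableSet_le measurable_norm measurable_const
  have hd' : (0 : ℝ) < d := by exact_mod_cast hd
  have h1 := mul_meas_ge_le_lintegral₀ (μ := stdGaussian (MatVec d))
    (f := fun g => ENNReal.ofReal (‖g‖ ^ 2)) (by fun_prop) (ENNReal.ofReal ((2 * d) ^ 2))
  rw [lintegral_norm_sq_stdGaussian, finrank_euclideanSpace, Fintype.card_prod,
    Fintype.card_fin] at h1
  have hsub : {g : MatVec d | ‖g‖ ≤ 2 * d}ᶜ ⊆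
      {g | ENNReal.ofReal ((2 * d) ^ 2) ≤ ENNReal.ofReal (‖g‖ ^ 2)} := fun g hg => by
    simp only [Set.mem_compl_iff, Set.mem_ofPred_eq, not_le] at hg ⊢
    exact ENNReal.ofReal_le_ofReal (by gcongr)
  have h2 := (mul_le_mul_right (measure_mono (μ := stdGaussian (MatVec d)) hsub)
    (ENNReal.ofReal ((2 * d) ^ 2))).trans h1
  rw [prob_compl_eq_one_sub hms] at h2
  set m := stdGaussian (MatVec d) {g | ‖g‖ ≤ 2 * d} with hm
  have hm1 : m ≤ 1 := prob_le_one
  lift m to NNReal using (hm1.trans_lt ENNReal.one_lt_top).ne with m'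
  have hm1' : m' ≤ 1 := by exact_mod_cast hm1
  have h3 := ENNReal.toReal_mono (ENNReal.natCast_ne_top _) h2
  rw [ENNReal.toReal_mul, ENNReal.toReal_ofReal (by positivity),
    ENNReal.toReal_sub_of_le hm1 (by simp)] at h3
  simp only [ENNReal.toReal_one, ENNReal.coe_toReal, ENNReal.toReal_natCast] at h3
  push_cast at h3
  have h4 : (1 : ℝ) / 2 ≤ m' := by
    by_contra! hlt
    nlinarith [mul_pos hd' hd']
  have h5 : (1 / 2 : NNReal) ≤ m' := by exact_mod_cast h4
  calc (1 / 2 : ℝ≥0∞) = ((1 / 2 : NNReal) : ℝ≥0∞) := by simp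
    _ ≤ _ := by exact_mod_cast h5

lemma invSqrt_four_pow (n : ℕ) : invSqrt (4 ^ n) = (1 / 2) ^ n := by
  induction n with
  | zero => simp [invSqrt_one]
  | succ n ih =>
    rw [pow_succ, invSqrt_mul (by positivity), ih, pow_succ]
    congr 1
    rw [invSqrt, ENNReal.ofReal_rpow_of_pos (by norm_num), show (4 : ℝ) = 2 ^ (2 : ℝ) by norm_num,
      ← Real.rpow_mul (by norm_num)]
    norm_num
    rw [ENNReal.ofReal_div_of_pos (by norm_num)]
    simp

lemma five_mul_invSqrt_le : 5 * invSqrt (2 ^ 80) ≤ (1 / 2) ^ 32 := by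
  -- Of the factor `2^(-40)`, eight halvings absorb the `5`.
  rw [show (2 : ℝ) ^ 80 = 4 ^ 40 by norm_num, invSqrt_four_pow,
    show 40 = 8 + 32 from rfl, pow_add, ← mul_assoc]
  have h5 : (5 : NNReal) * (1 / 2) ^ 8 ≤ 1 := by
    rw [← NNReal.coe_le_coe]
    push_cast
    norm_num
  refine mul_le_of_le_one_left' ?_
  calc (5 : ℝ≥0∞) * (1 / 2) ^ 8 = ((5 * (1 / 2) ^ 8 : NNReal) : ℝ≥0∞) := by
        rw [ENNReal.coe_mul, ENNReal.coe_pow, ENNReal.coe_div (by norm_num)]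
        simp
    _ ≤ 1 := by exact_mod_cast h5

lemma half_pow_le_exp (d : ℕ) : (1 / 2 : ℝ) ^ d ≤ Real.exp (-(d : ℝ) / 100) := by
  have h : (1 / 2 : ℝ) ≤ Real.exp (-1 / 100) := by
    have := Real.add_one_le_exp (-1 / 100 : ℝ)
    linarith
  calc (1 / 2 : ℝ) ^ d ≤ Real.exp (-1 / 100) ^ d := by gcongr
    _ = _ := by rw [← Real.exp_nat_mul]; ring_nf

section Random

variable {Ω : Type*} [MeasurableSpace Ω] {S : ℕ → Type*} [∀ t, MeasurableSpace (S t)]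
  (𝒜 : Algorithm d d Ω S) (P : Measure Ω) [IsProbabilityMeasure P]

/-- Some system of norm `O(d)` makes the state of the algorithm exponentially large after `d / 8`
steps, with high probability. -/
lemma exists_matrix_traj_large (hd : 32 ≤ d) :
    ∃ A : Matrix (Fin d) (Fin d) ℝ, ‖A‖ ≤ 2 ^ 81 * d ∧
      P {ω | ‖traj 𝒜 ω A (d / 8 - 1)‖ < 2 ^ d} ≤ ENNReal.ofReal (Real.exp (-(d : ℝ) / 100)) := by
  by_contra! hcon
  set n := d / 8 - 1 with hn
  set γ := stdGaussian (MatVec d)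
  have hmeas : Measurable fun p : MatVec d × Ω =>
      traj 𝒜 p.2 (toMat ((2 ^ 80 : ℝ) • p.1)) n :=
    measurable_traj 𝒜 (by fun_prop) measurable_snd n
  have hmeas' : Measurable fun p : MatVec d × Ω =>
      invSqrt ‖traj 𝒜 p.2 (toMat ((2 ^ 80 : ℝ) • p.1)) n‖ :=
    measurable_invSqrt.comp (measurable_norm.comp hmeas)
  set bad : Set (MatVec d × Ω) :=
    {p | ‖traj 𝒜 p.2 (toMat ((2 ^ 80 : ℝ) • p.1)) n‖ < 2 ^ d} with hbad
  have hbadm : MeasurableSet bad :=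
    measurableSet_lt (measurable_norm.comp hmeas) measurable_const
  -- Markov's inequality on the product space. The threshold `2^d` is weakened to `4^d`, for which
  -- `invSqrt` is exactly `2^(-d)`.
  have hupper : invSqrt (4 ^ d) * (γ.prod P) bad ≤ ((1 / 2) ^ 32) ^ n := by
    calc _ ≤ invSqrt (4 ^ d) * (γ.prod P) {p | invSqrt (4 ^ d) ≤
          invSqrt ‖traj 𝒜 p.2 (toMat ((2 ^ 80 : ℝ) • p.1)) n‖} := by
          gcongr
          intro p hp
          refine invSqrt_antitone (le_of_lt hp |>.trans ?_)
          gcongr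
          norm_num
      _ ≤ ∫⁻ p, invSqrt ‖traj 𝒜 p.2 (toMat ((2 ^ 80 : ℝ) • p.1)) n‖ ∂(γ.prod P) :=
          mul_meas_ge_le_lintegral hmeas' _
      _ = ∫⁻ ω, ∫⁻ g, invSqrt ‖traj 𝒜 ω (toMat ((2 ^ 80 : ℝ) • g)) n‖ ∂γ ∂P :=
          lintegral_prod_symm' _ hmeas'
      _ ≤ ∫⁻ _, ((1 / 2) ^ 32) ^ n ∂P := by
          refine lintegral_mono fun ω => ?_
          refine (lintegral_invSqrt_traj_le 𝒜 ω (by positivity) (by omega)).trans ?_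
          gcongr
          exact five_mul_invSqrt_le
      _ = _ := by simp
  -- If every matrix of norm at most `2^81 d` failed with probability above `exp(-d/100) ≥ 2^(-d)`,
  -- then so would every `2^80 g` with `‖g‖ ≤ 2 d`, a set of measure at least `1/2`.
  have hlower : (1 / 2 : ℝ≥0∞) ^ d * (1 / 2) ≤ (γ.prod P) bad := by
    have hms : MeasurableSet {g : MatVec d | ‖g‖ ≤ 2 * d} :=
      measurableSet_le measurable_norm measurable_const
    rw [Measure.prod_apply hbadm]
    calc (1 / 2 : ℝ≥0∞) ^ d * (1 / 2) ≤ (1 / 2 : ℝ≥0∞) ^ d * γ {g | ‖g‖ ≤ 2 * d} := by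
          gcongr
          exact stdGaussian_norm_le_ge (by omega)
      _ = ∫⁻ _ in {g : MatVec d | ‖g‖ ≤ 2 * d}, (1 / 2 : ℝ≥0∞) ^ d ∂γ := by
          rw [setLIntegral_const]
      _ ≤ ∫⁻ g in {g : MatVec d | ‖g‖ ≤ 2 * d}, P (Prod.mk g ⁻¹' bad) ∂γ := by
          refine setLIntegral_mono' hms fun g hg => ?_
          refine le_trans ?_ (hcon (toMat ((2 ^ 80 : ℝ) • g)) ?_).le
          · refine le_trans (le_of_eq ?_) (ENNReal.ofReal_le_ofReal (half_pow_le_exp d))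
            rw [ENNReal.ofReal_pow (by norm_num), ENNReal.ofReal_div_of_pos (by norm_num)]
            simp
          · refine (opNorm_toMat_le _).trans ?_
            rw [norm_smul]
            have : ‖g‖ ≤ 2 * d := hg
            norm_num
            linarith
      _ ≤ _ := setLIntegral_le_lintegral _ _
  have hfin : (1 / 2 : ℝ≥0∞) ^ (2 * d + 1) ≤ (1 / 2) ^ (32 * n) := by
    rw [pow_mul (1 / 2 : ℝ≥0∞) 32]
    refine le_trans ?_ hupper
    rw [invSqrt_four_pow]
    refine le_trans (le_of_eq ?_) (mul_le_mul_right hlower _)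
    ring
  -- With `n = d / 8 - 1`, the exponent `32 n` is at least `4 d - 60`, which exceeds `2 d + 1` once
  -- `d ≥ 32`.
  have hlt : (1 / 2 : ℝ≥0∞) ^ (32 * n) < (1 / 2) ^ (2 * d + 1) := by
    rw [one_div, ← ENNReal.inv_pow, ← ENNReal.inv_pow, ENNReal.inv_lt_inv]
    exact_mod_cast Nat.pow_lt_pow_right (a := 2) (by norm_num) (by omega)
  exact absurd hfin (not_le.2 hlt)

end Random

/-! ### The comparator and the regret -/

/-- The controller `u_t = -A x_t`, which drives the state to zero in one step. -/
def cancelling (A : Matrix (Fin d) (Fin d) ℝ) : DAC d d where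
  K := -A
  H := 0
  M := Fin.elim0

lemma stronglyStable_neg (A : Matrix (Fin d) (Fin d) ℝ) :
    StronglyStable A 1 (-A) (max 1 ‖A‖) 1 := by
  have h1 : ‖(1 : Matrix (Fin d) (Fin d) ℝ)‖ ≤ 1 :=
    opNorm_le_of_app _ zero_le_one fun x => by rw [app_one, one_mul]
  refine ⟨le_max_left _ _, one_pos, le_rfl, by simp, 1, 0, by simp, by simp, ?_, by simp⟩
  rw [inv_one]
  exact (mul_le_one₀ h1 (norm_nonneg _) h1).trans (le_max_left _ _)

lemma cancelling_mem_stableLinear (A : Matrix (Fin d) (Fin d) ℝ) :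
    cancelling A ∈ stableLinear (quadProblem A) :=
  ⟨rfl, _, _, stronglyStable_neg A⟩

lemma cancelling_input (A : Matrix (Fin d) (Fin d) ℝ) (t : ℕ) :
    (cancelling A).input (quadProblem A) 0 t =
      -app A ((cancelling A).state (quadProblem A) 0 t) := by
  have : IsEmpty (Fin (cancelling A).H) := inferInstanceAs (IsEmpty (Fin 0))
  rw [DAC.input, DAC.control, Finset.univ_eq_empty, Finset.sum_empty, add_zero]
  exact app_neg _ _

lemma cancelling_state_succ (A : Matrix (Fin d) (Fin d) ℝ) (t : ℕ) :
    (cancelling A).state (quadProblem A) 0 (t + 1) = 0 := by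
  have h := cancelling_input A t
  rw [DAC.input] at h
  rw [DAC.state, h]
  simp [Problem.step, quadProblem, app_one]

lemma cancelling_totalCost_le (hd : 0 < d) (A : Matrix (Fin d) (Fin d) ℝ) (n : ℕ) :
    (quadProblem A).totalCost (n + 1) ((cancelling A).state (quadProblem A) 0)
      ((cancelling A).input (quadProblem A) 0) ≤ 1 + ‖A‖ ^ 2 := by
  have h0 : (cancelling A).state (quadProblem A) 0 0 = e1 d := rfl
  have h1 := norm_app_le A (e1 d)
  rw [norm_e1 hd, mul_one] at h1
  rw [Problem.totalCost, Finset.sum_range_succ']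
  simp only [cancelling_input, cancelling_state_succ, h0]
  simp only [quadProblem, app_zero, norm_neg, norm_zero, norm_e1 hd]
  simp only [ne_eq, OfNat.ofNat_ne_zero, not_false_eq_true, zero_pow, add_zero,
    Finset.sum_const_zero, one_pow, zero_add]
  gcongr

lemma totalCost_nonneg (A : Matrix (Fin d) (Fin d) ℝ) (T : ℕ) (x u : ℕ → Vec d) :
    0 ≤ (quadProblem A).totalCost T x u :=
  Finset.sum_nonneg fun _ _ => add_nonneg (sq_nonneg _) (sq_nonneg _)

/-- The algorithm pays at least the squared norm of its last state. The infimum over `Pi` is at most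
the cost of `cancelling A`, since costs are bounded below by zero; without such a bound `sInf` would
carry no information. -/
lemma regret_ge {Ω : Type*} [MeasurableSpace Ω] {S : ℕ → Type*} [∀ t, MeasurableSpace (S t)]
    (𝒜 : Algorithm d d Ω S) (hd : 0 < d) (A : Matrix (Fin d) (Fin d) ℝ) {Pi : Set (DAC d d)}
    (hPi : cancelling A ∈ Pi) (n : ℕ) (ω : Ω) :
    ‖traj 𝒜 ω A n‖ ^ 2 - (1 + ‖A‖ ^ 2) ≤ regret 𝒜 (quadProblem A) 0 Pi (n + 1) ω := by
  have hinf := csInf_le ⟨0, by rintro _ ⟨π, -, rfl⟩; exact totalCost_nonneg A _ _ _⟩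
    (Set.mem_image_of_mem (fun π : DAC d d => (quadProblem A).totalCost (n + 1)
      (π.state (quadProblem A) 0) (π.input (quadProblem A) 0)) hPi)
  have hle := hinf.trans (cancelling_totalCost_le hd A n)
  have hcost : ‖traj 𝒜 ω A n‖ ^ 2 ≤ (quadProblem A).totalCost (n + 1)
      (𝒜.state (quadProblem A) 0 ω) (𝒜.input (quadProblem A) 0 ω) := by
    rw [Problem.totalCost]
    refine le_trans ?_ (Finset.single_le_sum (f := fun t => (quadProblem A).cost t
      (𝒜.state (quadProblem A) 0 ω t) (𝒜.input (quadProblem A) 0 ω t))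
      (fun _ _ => add_nonneg (sq_nonneg _) (sq_nonneg _)) (Finset.self_mem_range_succ n))
    exact le_add_of_nonneg_right (sq_nonneg _)
  rw [regret]
  linarith

/-! ### Parameters of the instance -/

lemma stronglyControllable_one (A : Matrix (Fin d) (Fin d) ℝ) :
    StronglyControllable A (1 : Matrix (Fin d) (Fin d) ℝ) 1 1 := by
  have h : controllabilityMatrix A (1 : Matrix (Fin d) (Fin d) ℝ) 1 *
      (controllabilityMatrix A (1 : Matrix (Fin d) (Fin d) ℝ) 1)ᵀ = 1 := by
    ext i j
    simp [controllabilityMatrix, Matrix.mul_apply, Fintype.sum_prod_type, Matrix.one_apply,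
      -Finset.sum_boole]
  refine ⟨?_, ?_⟩
  · rw [← Matrix.rank_self_mul_transpose, h, Matrix.rank_one, Fintype.card_fin]
  · rw [h, inv_one]
    exact opNorm_le_of_app _ zero_le_one fun x => by rw [app_one, one_mul]

lemma costGradientBound_sq :
    CostGradientBound (fun (x u : Vec d) => ‖x‖ ^ 2 + ‖u‖ ^ 2) 3 := by
  have heq : (fun p : WithLp 2 (Vec d × Vec d) => ‖p.fst‖ ^ 2 + ‖p.snd‖ ^ 2) =
      fun p => ‖p‖ ^ 2 := by
    funext p
    rw [WithLp.prod_norm_sq_eq_of_L2]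
  refine ⟨by simp, ?_, fun D p h1 h2 => ?_⟩
  · simp only [heq]
    exact (contDiff_norm_sq ℝ (n := 1)).differentiable (by norm_num)
  · have hg : HasGradientAt (fun p : WithLp 2 (Vec d × Vec d) => ‖p‖ ^ 2) ((2 : ℝ) • p) p := by
      have hdual : InnerProductSpace.toDual ℝ (WithLp 2 (Vec d × Vec d)) ((2 : ℝ) • p) =
          2 • innerSL ℝ p := by
        ext v
        rw [InnerProductSpace.toDual_apply_apply, real_inner_smul_left, two_mul, two_smul]
        rfl
      rw [hasGradientAt_iff_hasFDerivAt, hdual]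
      exact (hasStrictFDerivAt_norm_sq p).hasFDerivAt
    simp only [heq]
    rw [hg.gradient, norm_smul]
    have hD : 0 ≤ D := (norm_nonneg _).trans h1
    have hp : ‖p‖ ^ 2 ≤ 2 * D ^ 2 := by
      rw [WithLp.prod_norm_sq_eq_of_L2]
      have := pow_le_pow_left₀ (norm_nonneg _) h1 2
      have := pow_le_pow_left₀ (norm_nonneg _) h2 2
      linarith
    -- The gradient is `2 p` and `‖p‖ ≤ √2 D`, so `G = 3` works because `8 ≤ 9`.
    refine abs_le_of_sq_le_sq' ?_ (by positivity) |>.2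
    rw [mul_pow]
    norm_num
    nlinarith [sq_nonneg D]

lemma sq_le_two_pow {n : ℕ} (hn : 4 ≤ n) : n ^ 2 ≤ 2 ^ n := by
  induction n, hn using Nat.le_induction with
  | base => norm_num
  | succ n hn ih => rw [pow_succ 2 n]; nlinarith

end BlackBoxControl

/-! ### The lower bound -/

open BlackBoxControl in
theorem theorem2 :
    ∃ c C : ℝ, 0 < c ∧ 0 < C ∧ ∃ d₀ : ℕ, ∀ d : ℕ, d₀ ≤ d →
      ∀ (Ω : Type*) [MeasurableSpace Ω] (P : MeasureTheory.Measure Ω)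
        [MeasureTheory.IsProbabilityMeasure P]
        (S : ℕ → Type*) [∀ t, MeasurableSpace (S t)]
        (𝒜 : BlackBoxControl.Algorithm d d Ω S),
      ∃ (I : BlackBoxControl.Problem d d) (G β : ℝ),
        I.B = 1 ∧
        I.x₁ = BlackBoxControl.e1 d ∧
        (∀ t x u, I.cost t x u = ‖x‖ ^ 2 + ‖u‖ ^ 2) ∧
        BlackBoxControl.Stabilizable I.A I.B ∧
        BlackBoxControl.StronglyControllable I.A I.B 1 1 ∧
        I.HasParams 1 1 G β ∧
        BlackBoxControl.systemSize d d 1 1 G β ≤ C * d ∧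
        ENNReal.ofReal (1 - Real.exp (-(d : ℝ) / 100)) ≤
          P {ω |
            (2 : ℝ) ^ (c * BlackBoxControl.systemSize d d 1 1 G β) ≤
              BlackBoxControl.regret 𝒜 I 0 Set.univ (d / 8) ω ∧
            (2 : ℝ) ^ (c * BlackBoxControl.systemSize d d 1 1 G β) ≤
              BlackBoxControl.regret 𝒜 I 0 (BlackBoxControl.stableLinear I) (d / 8) ω} := by
  -- With `β = 2^81 d` and `G = 3` the complexity is `2 d + 4 + 2^81 d ≤ 2^82 d`. The choice `c =
  -- 2^(-82)` makes the target at most `2^d`.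
  refine ⟨(2 ^ 82)⁻¹, 2 ^ 82, by positivity, by positivity, 400, fun d hd Ω _ P _ S _ 𝒜 => ?_⟩
  obtain ⟨A, hA, hbad⟩ := exists_matrix_traj_large 𝒜 P (by omega : 32 ≤ d)
  have hdr : (400 : ℝ) ≤ d := by exact_mod_cast hd
  have hsize : systemSize d d 1 1 3 (2 ^ 81 * d) ≤ 2 ^ 82 * d := by
    rw [systemSize]
    push_cast
    linarith
  have hβ : (1 : ℝ) ≤ 2 ^ 81 * d := by linarith
  have hone : ‖(1 : Matrix (Fin d) (Fin d) ℝ)‖ ≤ 1 :=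
    opNorm_le_of_app _ zero_le_one fun x => by rw [app_one, one_mul]
  refine ⟨quadProblem A, 3, 2 ^ 81 * d, rfl, rfl, fun _ _ _ => rfl,
    ⟨_, _, _, stronglyStable_neg A⟩, stronglyControllable_one A,
    ⟨le_rfl, stronglyControllable_one A, hβ, hA, hone.trans hβ, fun _ => costGradientBound_sq⟩,
    hsize, ?_⟩
  have hpow : (2 : ℝ) ^ ((2 ^ 82 : ℝ)⁻¹ * systemSize d d 1 1 3 (2 ^ 81 * d)) ≤ 2 ^ d := by
    rw [← Real.rpow_natCast 2 d]
    refine Real.rpow_le_rpow_of_exponent_le (by norm_num) ?_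
    rw [inv_mul_le_iff₀ (by positivity)]
    exact hsize
  -- With `y = 2^d` and `d² ≤ y`, the comparator pays at most `1 + 2^162 y`. So `y² - 1 - 2^162 y ≥
  -- y` is enough, and it holds since `y ≥ 2^162 + 2`.
  have hnum : (2 : ℝ) ^ d ≤ (2 ^ d) ^ 2 - (1 + ‖A‖ ^ 2) := by
    have h1 : ‖A‖ ^ 2 ≤ 2 ^ 162 * (2 : ℝ) ^ d := by
      calc ‖A‖ ^ 2 ≤ (2 ^ 81 * (d : ℝ)) ^ 2 := by gcongr
        _ = 2 ^ 162 * (d : ℝ) ^ 2 := by ring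
        _ ≤ _ := by
          gcongr
          exact_mod_cast sq_le_two_pow (by omega : 4 ≤ d)
    have h3 : (2 : ℝ) ^ 163 ≤ 2 ^ d := pow_le_pow_right₀ (by norm_num) (by omega)
    generalize (2 : ℝ) ^ d = y at *
    have h4 : (2 : ℝ) ^ 162 + 2 ≤ y := le_trans (by norm_num) h3
    nlinarith [mul_le_mul_of_nonneg_right h4 (le_trans (by positivity) h3 : (0 : ℝ) ≤ y)]
  -- Time starts at `0`, so the last of the `d / 8` states has index `d / 8 - 1`.
  have hd8 : d / 8 - 1 + 1 = d / 8 := by omega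
  have hgood : {ω | ‖traj 𝒜 ω A (d / 8 - 1)‖ < 2 ^ d}ᶜ ⊆ {ω |
      (2 : ℝ) ^ ((2 ^ 82 : ℝ)⁻¹ * systemSize d d 1 1 3 (2 ^ 81 * d)) ≤
        regret 𝒜 (quadProblem A) 0 Set.univ (d / 8) ω ∧
      (2 : ℝ) ^ ((2 ^ 82 : ℝ)⁻¹ * systemSize d d 1 1 3 (2 ^ 81 * d)) ≤
        regret 𝒜 (quadProblem A) 0 (stableLinear (quadProblem A)) (d / 8) ω} := by
    intro ω hω
    simp only [Set.mem_compl_iff, Set.mem_ofPred_eq, not_lt] at hω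
    have h1 : (2 : ℝ) ^ ((2 ^ 82 : ℝ)⁻¹ * systemSize d d 1 1 3 (2 ^ 81 * d)) ≤
        ‖traj 𝒜 ω A (d / 8 - 1)‖ ^ 2 - (1 + ‖A‖ ^ 2) :=
      (hpow.trans hnum).trans (sub_le_sub_right (pow_le_pow_left₀ (by positivity) hω 2) _)
    rw [← hd8]
    exact ⟨h1.trans (regret_ge 𝒜 (by omega) A (Set.mem_univ _) _ ω),
      h1.trans (regret_ge 𝒜 (by omega) A (cancelling_mem_stableLinear A) _ ω)⟩
  refine le_trans ?_ (measure_mono hgood)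
  have hmeas : MeasurableSet {ω | ‖traj 𝒜 ω A (d / 8 - 1)‖ < 2 ^ d} :=
    measurableSet_lt (measurable_norm.comp (measurable_traj 𝒜
      (M := fun _ => WithLp.toLp 2 fun p : Fin d × Fin d => A p.1 p.2) measurable_const
      measurable_id _)) measurable_const
  rw [prob_compl_eq_one_sub hmeas, ENNReal.ofReal_sub _ (Real.exp_nonneg _), ENNReal.ofReal_one]
  exact tsub_le_tsub_left hbad _
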